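/- (Basis Theorem) Let $\mathbb K$ be a field of characteristic zero, $V$ a $\mathbb K$-vector space of finite dimension $r\ge 1$, $U=V^*$, and let $X=(x_1,\dots,x_N)$ be a finite sequence in $U$ whose elements span $U$; zero vectors and repetitions are allowed. Subsequences of $X$ are identified with sets of positions, and $X$ is ordered by position. For $Y\subseteq X$ let $\operatorname{rk}(Y)=\dim\operatorname{span}(Y)$ and $\operatorname{clos}(Y)=\{x\in X:\operatorname{rk}(Y\cup x)=\operatorname{rk}(Y)\}$. A flat is a subsequence $C$ with $\operatorname{clos}(C)=C$. Let $J$ be a non-empty upper set in the lattice $\mathcal L(X)$ of flats ordered by inclusion, and for $A\subseteq X$ let $\chi(A)=1$ if $\operatorname{clos}(A)\in J$ and $\chi(A)=0$ otherwise. For $x\in X$ let $p_x$ be the image of $x$ in $\operatorname{Sym}(U)$, and let $p_Y=\prod_{x\in Y}p_x$ for $Y\subseteq X$. Let $k\ge 0$ be an integer and let $\mathcal P(X,k,J)\subseteq \operatorname{Sym}(U)$ be the linear span of $$\{\,p_Y : Y\subseteq X,\ \operatorname{clos}(X\setminus Y)\in J\,\}\quad\text{if } k=0,$$ $$\{\,f\,p_Y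 : Y\subseteq X,\ f\in\operatorname{Sym}(U),\ 0\le\deg f\le \chi(X\setminus Y)+k-1\,\}\quad\text{if } k\ge 1.$$ A basis of $X$ is a subsequence $B$ with $|B|=\operatorname{rk}(B)=r$. An element $b\in B$ is internally active if $b=\max(X\setminus\operatorname{clos}(B\setminus b))$; an element $x\in X\setminus B$ is externally active with respect to $B$ if $x\in\operatorname{clos}\{b\in B: b\le x\}$. Let $I(B)$ and $E(B)$ be the sets of internally active elements of $B$ and of externally active elements with respect to $B$. Let $\Gamma(X,k,J)$ be the set of all triples $(B,I,a)$ where $B$ is a basis of $X$, $I\subseteq I(B)$, $a=(a_x)_{x\in I}\in\mathbb N^I$ (with $0\in\mathbb N$), and $$\sum_{x\in I}a_x\le k+\chi\bigl((B\cup E(B))\setminus I\bigr)-1 .$$ Then the set $$\mathcal B(X,k,J)=\Bigl\{\,p_{X\setminus(B\cup E(B))}\prod_{x\in I}p_x^{a_x+1} : (B,I,a)\in\Gamma(X,k,J)\Bigr\}$$ is a basis of the vector space $\mathcal P(X,k,J)$, and distinct elements of $\Gamma(X,k,J)$ give distinct polynomials. -/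

import Mathlib

namespace Zonotopal

open Module

section

variable (K : Type*) [Field K] {U : Type*} [AddCommGroup U] [Module K U]
variable {ι : Type*} [Fintype ι] [LinearOrder ι] (X : ι → U)

/-- The rank of the subsequence `Y` of the sequence `X`. Subsequences are given by their sets of
indices, so equal vectors at different positions are distinguished. -/
noncomputable def rank (Y : Finset ι) : ℕ :=
  finrank K (Submodule.span K (X '' (Y : Set ι)))

/-- The closure of `Y` in `X`: all `x` whose addition to `Y` does not change the rank. -/
noncomputable def clos (Y : Finset ι) : Finset ι :=
  Finset.univ.filter fun x => rank K X (insert x Y) = rank K X Y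

theorem mem_clos_iff (Y : Finset ι) (x : ι) :
    x ∈ clos K X Y ↔ X x ∈ Submodule.span K (X '' (Y : Set ι)) := by
  have hle : Submodule.span K (X '' (Y : Set ι)) ≤
      Submodule.span K (X '' ((insert x Y : Finset ι) : Set ι)) :=
    Submodule.span_mono (Set.image_mono (by simp))
  have hfin : FiniteDimensional K
      (Submodule.span K (X '' ((insert x Y : Finset ι) : Set ι))) :=
    FiniteDimensional.span_of_finite K (Set.toFinite _)
  simp only [clos, Finset.mem_filter, Finset.mem_univ, true_and]
  unfold rank
  constructor
  · intro h
    rw [Submodule.eq_of_le_of_finrank_eq hle h.symm]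
    exact Submodule.subset_span ⟨x, by simp, rfl⟩
  · intro h
    rw [Finset.coe_insert, Set.image_insert_eq, Submodule.span_insert_eq_span h]

theorem clos_clos (Y : Finset ι) : clos K X (clos K X Y) = clos K X Y := by
  ext x
  rw [mem_clos_iff, mem_clos_iff]
  have : Submodule.span K (X '' (clos K X Y : Set ι)) = Submodule.span K (X '' (Y : Set ι)) := by
    apply le_antisymm
    · rw [Submodule.span_le]
      rintro _ ⟨y, hy, rfl⟩
      exact (mem_clos_iff K X Y y).1 hy
    · refine Submodule.span_mono (Set.image_mono fun y hy => ?_)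
      exact (mem_clos_iff K X Y y).2 (Submodule.subset_span ⟨y, hy, rfl⟩)
  rw [this]

/-- The lattice of flats of `X`, ordered by inclusion. -/
abbrev Flat : Type _ := {C : Finset ι // clos K X C = C}

/-- The closure of `A`, as an element of the lattice of flats. -/
noncomputable def closFlat (A : Finset ι) : Flat K X := ⟨clos K X A, clos_clos K X A⟩

variable {K X} in
open Classical in
/-- The indicator function of the upper set `J`, extended to all subsequences `A` of `X` by
`χ(A) = χ(clos A)`. -/
noncomputable def chi (J : UpperSet (Flat K X)) (A : Finset ι) : ℕ :=
  if closFlat K X A ∈ J then 1 else 0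

/-- Bases of `X`: subsequences of cardinality `r` and rank `r`, where `r = dim U`. -/
def IsBase (B : Finset ι) : Prop :=
  B.card = finrank K U ∧ rank K X B = finrank K U

open Classical in
/-- The set `I(B)` of internally active elements of `B`: those `b ∈ B` with
`b = max (X ∖ clos (B ∖ b))`. -/
noncomputable def intAct (B : Finset ι) : Finset ι :=
  B.filter fun b => IsGreatest {x : ι | x ∉ clos K X (B.erase b)} b

/-- The set `E(B)` of externally active elements with respect to `B`: those `x ∈ X ∖ B` with
`x ∈ clos {b ∈ B : b ≤ x}`. -/
noncomputable def extAct (B : Finset ι) : Finset ι :=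
  (Bᶜ).filter fun x => x ∈ clos K X (B.filter fun b => b ≤ x)

/-- The element `p_x` of `Sym(U)`, for an element `x` of the sequence `X`. -/
noncomputable def pElem (x : ι) : SymmetricAlgebra K U := SymmetricAlgebra.ι K U (X x)

/-- `p_Y = ∏_{x ∈ Y} p_x`. -/
noncomputable def pProd (Y : Finset ι) : SymmetricAlgebra K U := ∏ x ∈ Y, pElem K X x

variable (U) in
/-- The elements of `Sym(U)` of degree at most `d`. The homogeneous component of degree `n` is
spanned by the products of `n` elements of `U`. -/
noncomputable def degLE (d : ℕ) : Submodule K (SymmetricAlgebra K U) :=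
  ⨆ n ∈ Finset.range (d + 1), LinearMap.range (SymmetricAlgebra.ι K U) ^ n

variable {K X}

/-- The generating set `S(X,k,J)` for `k ≥ 0`. In the case `k + 1`, the degree bound
`χ(X ∖ Y) + (k + 1) - 1` is written `χ(X ∖ Y) + k`. -/
def genSet (J : UpperSet (Flat K X)) : ℕ → Set (SymmetricAlgebra K U)
  | 0 => {g | ∃ Y : Finset ι, closFlat K X Yᶜ ∈ J ∧ g = pProd K X Y}
  | k + 1 => {g | ∃ (Y : Finset ι) (f : SymmetricAlgebra K U),
      f ≠ 0 ∧ f ∈ degLE K U (chi J Yᶜ + k) ∧ g = f * pProd K X Y}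

/-- The space `P(X,k,J)` for `k ≥ 0`. -/
def PSpace (k : ℕ) (J : UpperSet (Flat K X)) : Submodule K (SymmetricAlgebra K U) :=
  Submodule.span K (genSet J k)

/-- The index set `Γ(X,k,J)` of triples `(B, I, a)`. The inequality is one between integers: its
right-hand side may be `-1`. -/
structure Gamma (k : ℕ) (J : UpperSet (Flat K X)) where
  B : Finset ι
  isBase : IsBase K X B
  I : Finset ι
  subset_intAct : I ⊆ intAct K X B
  a : {x // x ∈ I} → ℕ
  sum_le : ∑ x, (a x : ℤ) ≤ (k : ℤ) + (chi J ((B ∪ extAct K X B) \ I) : ℤ) - 1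

/-- The polynomial `p_{X ∖ (B ∪ E(B))} ∏_{x ∈ I} p_x ^ (a_x + 1)` with index `(B, I, a)`. -/
noncomputable def Gamma.poly {k : ℕ} {J : UpperSet (Flat K X)} (γ : Gamma k J) :
    SymmetricAlgebra K U :=
  pProd K X (γ.B ∪ extAct K X γ.B)ᶜ * ∏ x : {x // x ∈ γ.I}, pElem K X x.1 ^ (γ.a x + 1)

/-- The set `B(X,k,J)`. -/
def basisSet (k : ℕ) (J : UpperSet (Flat K X)) : Set (SymmetricAlgebra K U) :=
  Set.range fun γ : Gamma k J => γ.poly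

end

end Zonotopal

/-! Put A = (B ∪ E(B)) ∖ I. Since I ⊆ B, the polynomial of (B, I, a) is p_{X∖A} ∏_{x∈I} p_x^{a_x}.
The sets A that occur are exactly the saturated ones, and A determines B and I
(`IsBase.saturated_sdiff`, `Saturated.exists_isBase`, `Gamma.ext_sat`).

Spanning (`mul_pProd_mem_span_basisSet`): in f p_{X∖A}, an unsaturated A is replaced by sets of the
same span in which some z gives way to a later y. For saturated A, expand f in monomials over B.
Those supported on I give basis elements; in any other, a factor p_b with b ∈ B ∖ I ⊆ A is absorbed
into p_{X∖A}, which costs one degree while χ drops by at most one.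

Independence (`Gamma.eq_zero_of_quotMap`): decide membership in A element by element, in increasing
order, working in Sym(U / span of the elements accepted so far). At a, the terms with a ∉ A carry
the factor p_a. Killing p_a isolates the terms with a ∈ A; once these are gone, p_a can be cancelled
in a domain, unless it is zero, and then saturation rules out a ∉ A. At the end A is fixed, and
distinct monomials in a basis of the quotient remain (`Gamma.eq_zero_of_sat_eq`). -/

namespace Zonotopal

open Module

/-! ### Bases, expansions and activities. -/

section Matroid

variable {K : Type*} [Field K] {U : Type*} [AddCommGroup U] [Module K U]
variable {ι : Type*} {X : ι → U}

variable (K X) in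
/-- The span of the subsequence `Y` of `X`. -/
def spanOf (Y : Finset ι) : Submodule K U := Submodule.span K (X '' (Y : Set ι))

theorem mem_spanOf {Y : Finset ι} {x : ι} (hx : x ∈ Y) : X x ∈ spanOf K X Y :=
  Submodule.subset_span ⟨x, hx, rfl⟩

theorem spanOf_le {Y : Finset ι} {W : Submodule K U} :
    spanOf K X Y ≤ W ↔ ∀ x ∈ Y, X x ∈ W := by
  rw [spanOf, Submodule.span_le]
  exact Set.image_subset_iff

theorem spanOf_mono {Y Z : Finset ι} (h : Y ⊆ Z) : spanOf K X Y ≤ spanOf K X Z :=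
  spanOf_le.2 fun _ hx => mem_spanOf (h hx)

theorem IsBase.linearIndepOn {B : Finset ι} (hB : IsBase K X B) :
    LinearIndepOn K X (B : Set ι) := by
  have h : Fintype.card (B : Set ι) = (Set.range fun x : (B : Set ι) => X x).finrank K := by
    have h1 : (Set.range fun x : (B : Set ι) => X x) = X '' (B : Set ι) :=
      (Set.image_eq_range X (B : Set ι)).symm
    rw [h1]
    simp only [Finset.coe_sort_coe, Fintype.card_coe]
    exact hB.1.trans hB.2.symm
  exact linearIndependent_iff_card_eq_finrank_span.2 h

theorem IsBase.spanOf_eq_top [FiniteDimensional K U] {B : Finset ι} (hB : IsBase K X B) :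
    spanOf K X B = ⊤ :=
  Submodule.eq_top_of_finrank_eq hB.2

theorem isBase_of_linearIndepOn {B : Finset ι} (hB : LinearIndepOn K X (B : Set ι))
    (htop : spanOf K X B = ⊤) : IsBase K X B := by
  have h : rank K X B = finrank K U := by
    change finrank K (spanOf K X B) = _
    rw [htop, finrank_top]
  refine ⟨?_, h⟩
  rw [← h]
  have h2 := finrank_span_eq_card hB
  rw [← Set.image_eq_range X (B : Set ι)] at h2
  simp only [Finset.coe_sort_coe, Fintype.card_coe] at h2
  exact h2.symm

theorem IsBase.notMem_spanOf_erase [DecidableEq ι] {B : Finset ι} (hB : IsBase K X B) {b : ι}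
    (hb : b ∈ B) : X b ∉ spanOf K X (B.erase b) := by
  have h := hB.linearIndepOn
  rw [← Finset.insert_erase hb, Finset.coe_insert, linearIndepOn_insert (by simp)] at h
  exact h.2

section Expansion

variable [FiniteDimensional K U]

/-- The basis of `U` given by a basis `B` of `X`. -/
noncomputable def IsBase.basis {B : Finset ι} (hB : IsBase K X B) : Basis (B : Set ι) K U :=
  Basis.mk hB.linearIndepOn (by
    rw [← Set.image_eq_range X (B : Set ι)]
    exact hB.spanOf_eq_top.ge)

theorem IsBase.basis_apply {B : Finset ι} (hB : IsBase K X B) (b : (B : Set ι)) :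
    hB.basis b = X b := by
  simp [IsBase.basis]

/-- For a basis `B` of `X`, the set of elements of `B` that occur in the expansion of `x`. -/
noncomputable def IsBase.supp {B : Finset ι} (hB : IsBase K X B) (x : ι) : Finset ι :=
  (hB.basis.repr (X x)).support.map (Function.Embedding.subtype _)

theorem IsBase.supp_subset {B : Finset ι} (hB : IsBase K X B) (x : ι) : hB.supp x ⊆ B := by
  intro b hb
  simp only [IsBase.supp, Finset.mem_map] at hb
  obtain ⟨c, -, rfl⟩ := hb
  exact c.2

theorem IsBase.mem_spanOf_supp {B : Finset ι} (hB : IsBase K X B) (x : ι) :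
    X x ∈ spanOf K X (hB.supp x) := by
  have h := hB.basis.mem_span_repr_support (X x)
  refine Submodule.span_mono ?_ h
  rintro _ ⟨b, hb, rfl⟩
  exact ⟨b, by simpa [IsBase.supp] using hb, (hB.basis_apply b).symm⟩

theorem IsBase.supp_subset_of_mem {B Y : Finset ι} (hB : IsBase K X B) {x : ι} (hY : Y ⊆ B)
    (h : X x ∈ spanOf K X Y) : hB.supp x ⊆ Y := by
  have h1 : X '' (Y : Set ι) = hB.basis '' {b : (B : Set ι) | b.1 ∈ Y} := by
    ext u
    constructor
    · rintro ⟨y, hy, rfl⟩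
      exact ⟨⟨y, hY hy⟩, hy, hB.basis_apply _⟩
    · rintro ⟨b, hb, rfl⟩
      exact ⟨b, hb, (hB.basis_apply b).symm⟩
  rw [spanOf, h1, Basis.mem_span_image] at h
  intro b hb
  simp only [IsBase.supp, Finset.mem_map] at hb
  obtain ⟨c, hc, rfl⟩ := hb
  exact h hc

theorem IsBase.notMem_supp [DecidableEq ι] {B : Finset ι} (hB : IsBase K X B) {b x : ι}
    (h : X x ∈ spanOf K X (B.erase b)) : b ∉ hB.supp x := fun hb => by
  simpa using hB.supp_subset_of_mem (Finset.erase_subset b B) h hb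

end Expansion

variable [Fintype ι] [LinearOrder ι]

theorem mem_clos {Y : Finset ι} {x : ι} : x ∈ clos K X Y ↔ X x ∈ spanOf K X Y :=
  mem_clos_iff K X Y x

theorem chi_congr (J : UpperSet (Flat K X)) {A A' : Finset ι}
    (h : spanOf K X A = spanOf K X A') : chi J A = chi J A' := by
  have : closFlat K X A = closFlat K X A' := by
    apply Subtype.ext
    ext x
    change x ∈ clos K X A ↔ x ∈ clos K X A'
    rw [mem_clos, mem_clos, h]
  rw [chi, chi, this]

theorem chi_le_one (J : UpperSet (Flat K X)) (A : Finset ι) : chi J A ≤ 1 := by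
  unfold chi
  split_ifs <;> simp

theorem mem_intAct {B : Finset ι} {b : ι} : b ∈ intAct K X B ↔
    b ∈ B ∧ X b ∉ spanOf K X (B.erase b) ∧ ∀ x, b < x → X x ∈ spanOf K X (B.erase b) := by
  have h : b ∈ intAct K X B ↔ b ∈ B ∧ b ∉ clos K X (B.erase b) ∧
      ∀ x, x ∉ clos K X (B.erase b) → x ≤ b := by
    classical
    unfold intAct
    exact Finset.mem_filter
  rw [h]
  simp only [mem_clos, ← not_lt, not_imp_not]

theorem mem_extAct {B : Finset ι} {x : ι} : x ∈ extAct K X B ↔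
    x ∉ B ∧ X x ∈ spanOf K X (B.filter (· ≤ x)) := by
  simp [extAct, mem_clos]

variable [FiniteDimensional K U]

/-- If b occurs in x, then x lies outside the span of B ∖ b, and an internally active b is the last
such element. -/
theorem IsBase.le_of_mem_supp {B : Finset ι} (hB : IsBase K X B) {b x : ι}
    (hb : b ∈ intAct K X B) (h : b ∈ hB.supp x) : x ≤ b := by
  by_contra hlt
  exact hB.notMem_supp ((mem_intAct.1 hb).2.2 x (not_le.1 hlt)) h

theorem IsBase.supp_subset_filter {B : Finset ι} (hB : IsBase K X B) {x : ι}
    (hx : x ∈ extAct K X B) : hB.supp x ⊆ B.filter (· < x) := by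
  intro b hb
  obtain ⟨hxB, hx⟩ := mem_extAct.1 hx
  have h := hB.supp_subset_of_mem (Finset.filter_subset _ B) hx hb
  rw [Finset.mem_filter] at h ⊢
  exact ⟨h.1, lt_of_le_of_ne h.2 fun e => hxB (e ▸ h.1)⟩

theorem IsBase.notMem_supp_of_extAct {B : Finset ι} (hB : IsBase K X B) {b x : ι}
    (hx : x ∈ extAct K X B) (hb : b ∈ intAct K X B) : b ∉ hB.supp x := fun h =>
  (hB.le_of_mem_supp hb h).not_gt (Finset.mem_filter.1 (hB.supp_subset_filter hx h)).2

/-! ### Saturated subsequences and their correspondence with pairs (B, I). -/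

variable (K X) in
/-- A subsequence is saturated if it contains every `y ∈ X` which is in the span of its elements
that precede `y`. -/
def Saturated (A : Finset ι) : Prop := ∀ y, X y ∈ spanOf K X (A.filter (· < y)) → y ∈ A

section ActiveSet

variable {B I : Finset ι} (hB : IsBase K X B) (hI : I ⊆ intAct K X B)
include hB hI

theorem IsBase.supp_subset_sdiff {x : ι} (hx : x ∈ extAct K X B) : hB.supp x ⊆ B \ I := by
  intro b hb
  exact Finset.mem_sdiff.2 ⟨hB.supp_subset x hb, fun h => hB.notMem_supp_of_extAct hx (hI h) hb⟩

theorem IsBase.spanOf_sdiff :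
    spanOf K X ((B ∪ extAct K X B) \ I) ≤ spanOf K X (B \ I) := by
  refine spanOf_le.2 fun x hx => ?_
  rw [Finset.mem_sdiff, Finset.mem_union] at hx
  obtain ⟨h | h, hxI⟩ := hx
  · exact mem_spanOf (Finset.mem_sdiff.2 ⟨h, hxI⟩)
  · exact spanOf_mono (hB.supp_subset_sdiff hI h) (hB.mem_spanOf_supp x)

omit hI in
theorem IsBase.spanOf_filter_lt (y : ι) :
    spanOf K X (((B ∪ extAct K X B) \ I).filter (· < y)) ≤ spanOf K X (B.filter (· < y)) := by
  refine spanOf_le.2 fun x hx => ?_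
  rw [Finset.mem_filter, Finset.mem_sdiff, Finset.mem_union] at hx
  obtain ⟨⟨h | h, -⟩, hxy⟩ := hx
  · exact mem_spanOf (Finset.mem_filter.2 ⟨h, hxy⟩)
  · refine spanOf_mono (fun b hb => ?_) (hB.mem_spanOf_supp x)
    have := hB.supp_subset_filter h hb
    rw [Finset.mem_filter] at this ⊢
    exact ⟨this.1, this.2.trans hxy⟩

/-- The elements of the set before y lie in the span of the elements of B before y. So y cannot be
in B, hence not in I, and is externally active. -/
theorem IsBase.saturated_sdiff : Saturated K X ((B ∪ extAct K X B) \ I) := by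
  intro y hy
  have h1 := hB.spanOf_filter_lt y hy
  have hyB : y ∉ B := fun hyB => hB.notMem_spanOf_erase hyB
    (spanOf_mono (fun b hb => by
      rw [Finset.mem_filter] at hb
      exact Finset.mem_erase.2 ⟨hb.2.ne, hb.1⟩) h1)
  rw [Finset.mem_sdiff, Finset.mem_union]
  refine ⟨Or.inr (mem_extAct.2 ⟨hyB, spanOf_mono ?_ h1⟩), fun h => hyB (mem_intAct.1 (hI h)).1⟩
  exact Finset.monotone_filter_right _ fun _ _ h => le_of_lt h

/-- Recovers I from the saturated set alone. For x ∉ B, every b ∈ I in the expansion of x comes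
after x. -/
theorem IsBase.mem_active_iff (x : ι) : x ∈ I ↔
    X x ∉ spanOf K X ((B ∪ extAct K X B) \ I ∪ Finset.univ.filter (x < ·)) := by
  constructor
  · intro hx h
    obtain ⟨-, h1, h2⟩ := mem_intAct.1 (hI hx)
    refine h1 ((spanOf_le.2 fun z hz => ?_ : spanOf K X _ ≤ _) h)
    rcases Finset.mem_union.1 hz with hz | hz
    · refine spanOf_mono (fun b hb => ?_) (hB.spanOf_sdiff hI (mem_spanOf hz))
      rw [Finset.mem_sdiff] at hb
      exact Finset.mem_erase.2 ⟨fun e => hb.2 (e ▸ hx), hb.1⟩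
    · exact h2 z (by simpa using hz)
  · intro h
    by_contra hxI
    have hxA : x ∉ (B ∪ extAct K X B) \ I := fun hx => h (mem_spanOf (Finset.mem_union_left _ hx))
    have hxB : x ∉ B := fun hx =>
      hxA (Finset.mem_sdiff.2 ⟨Finset.mem_union_left _ hx, hxI⟩)
    refine h (spanOf_mono (fun b hb => ?_) (hB.mem_spanOf_supp x))
    have hbB := hB.supp_subset x hb
    by_cases hbI : b ∈ I
    · have := hB.le_of_mem_supp (hI hbI) hb
      exact Finset.mem_union_right _
        (by simpa using lt_of_le_of_ne this fun e => hxB (e ▸ hbB))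
    · exact Finset.mem_union_left _ (Finset.mem_sdiff.2 ⟨Finset.mem_union_left _ hbB, hbI⟩)

/-- Recovers B from I and the saturated set: B ∖ I is the greedy basis of that set, taken from the
smallest element upwards. -/
theorem IsBase.mem_base_iff (x : ι) : x ∈ B ↔ x ∈ I ∨ x ∈ (B ∪ extAct K X B) \ I ∧
    X x ∉ spanOf K X (((B ∪ extAct K X B) \ I).filter (· < x)) := by
  constructor
  · intro hx
    by_cases hxI : x ∈ I
    · exact Or.inl hxI
    refine Or.inr ⟨Finset.mem_sdiff.2 ⟨Finset.mem_union_left _ hx, hxI⟩, fun h => ?_⟩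
    refine hB.notMem_spanOf_erase hx (spanOf_mono (fun b hb => ?_) (hB.spanOf_filter_lt x h))
    rw [Finset.mem_filter] at hb
    exact Finset.mem_erase.2 ⟨hb.2.ne, hb.1⟩
  · rintro (h | ⟨h, h1⟩)
    · exact (mem_intAct.1 (hI h)).1
    · by_contra hxB
      have hxE : x ∈ extAct K X B := by
        rw [Finset.mem_sdiff, Finset.mem_union] at h
        exact h.1.resolve_left hxB
      refine h1 (spanOf_mono (fun b hb => ?_) (hB.mem_spanOf_supp x))
      have h2 := Finset.mem_sdiff.1 (hB.supp_subset_sdiff hI hxE hb)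
      exact Finset.mem_filter.2 ⟨Finset.mem_sdiff.2 ⟨Finset.mem_union_left _ h2.1, h2.2⟩,
        (Finset.mem_filter.1 (hB.supp_subset_filter hxE hb)).2⟩

end ActiveSet

open Classical in
/-- Every saturated subsequence arises from a basis of `X` and a set of internally active
elements. -/
theorem Saturated.exists_isBase (hX : Submodule.span K (Set.range X) = ⊤) {A : Finset ι}
    (hA : Saturated K X A) : ∃ B I, IsBase K X B ∧ I ⊆ intAct K X B ∧
      A = (B ∪ extAct K X B) \ I := by
  -- Two greedy choices: a basis of A from below, then its completion to a basis of U from above.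
  set B₀ := A.filter fun a => X a ∉ spanOf K X (A.filter (· < a)) with hB₀
  set I := Finset.univ.filter fun x => X x ∉ spanOf K X (A ∪ Finset.univ.filter (x < ·)) with hI
  have memB₀ : ∀ a, a ∈ B₀ ↔ a ∈ A ∧ X a ∉ spanOf K X (A.filter (· < a)) := by simp [hB₀]
  have memI : ∀ x, x ∈ I ↔ X x ∉ spanOf K X (A ∪ Finset.univ.filter (x < ·)) := by simp [hI]
  have hIA : ∀ x ∈ I, x ∉ A := fun x hx h =>
    (memI x).1 hx (mem_spanOf (Finset.mem_union_left _ h))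
  have low : ∀ a ∈ A, X a ∈ spanOf K X (B₀.filter (· ≤ a)) := by
    intro a
    induction a using WellFoundedLT.induction with
    | ind a ih =>
      intro ha
      by_cases h : X a ∈ spanOf K X (A.filter (· < a))
      · refine (spanOf_le.2 fun z hz => ?_ : spanOf K X _ ≤ _) h
        rw [Finset.mem_filter] at hz
        exact spanOf_mono (Finset.monotone_filter_right _ fun _ _ h => le_trans h hz.2.le)
          (ih z hz.2 hz.1)
      · exact mem_spanOf (by simp [memB₀, ha, h])
  have lowA : ∀ a ∈ A, X a ∈ spanOf K X B₀ := fun a ha =>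
    spanOf_mono (Finset.filter_subset _ _) (low a ha)
  have high : ∀ x, X x ∈ spanOf K X (B₀ ∪ I.filter (x ≤ ·)) := by
    intro x
    induction x using WellFoundedGT.induction with
    | ind x ih =>
      by_cases h : X x ∈ spanOf K X (A ∪ Finset.univ.filter (x < ·))
      · refine (spanOf_le.2 fun z hz => ?_ : spanOf K X _ ≤ _) h
        rcases Finset.mem_union.1 hz with hz | hz
        · exact spanOf_mono Finset.subset_union_left (lowA z hz)
        · have hz : x < z := by simpa using hz
          exact spanOf_mono (Finset.union_subset_union_right
            (Finset.monotone_filter_right _ fun _ _ h => le_trans hz.le h)) (ih z hz)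
      · exact mem_spanOf (by simp [memI, h])
  have ind₀ : ∀ S : Finset ι, S ⊆ B₀ → LinearIndepOn K X (S : Set ι) := by
    intro S
    induction S using Finset.induction_on_max with
    | empty => intro _; simp
    | insert a s hs ih =>
      intro h
      rw [Finset.insert_subset_iff] at h
      rw [Finset.coe_insert]
      refine (ih h.2).insert fun h1 => ((memB₀ a).1 h.1).2 (spanOf_mono (fun x hx => ?_) h1)
      exact Finset.mem_filter.2 ⟨((memB₀ x).1 (h.2 hx)).1, hs x hx⟩
  -- Elements of I are added in decreasing order, since each is independent of A and everything
  -- after it.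
  have ind : ∀ S : Finset ι, S ⊆ I → LinearIndepOn K X ((B₀ ∪ S : Finset ι) : Set ι) := by
    intro S
    induction S using Finset.induction_on_min with
    | empty => intro _; simpa using ind₀ B₀ subset_rfl
    | insert a s hs ih =>
      intro h
      rw [Finset.insert_subset_iff] at h
      rw [Finset.union_insert, Finset.coe_insert]
      refine (ih h.2).insert fun h1 => (memI a).1 h.1 (spanOf_mono (fun x hx => ?_) h1)
      rcases Finset.mem_union.1 hx with hx | hx
      · exact Finset.mem_union_left _ ((memB₀ x).1 hx).1
      · exact Finset.mem_union_right _ (by simpa using hs x hx)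
  have hB : IsBase K X (B₀ ∪ I) := by
    refine isBase_of_linearIndepOn (ind I subset_rfl) (top_le_iff.1 ?_)
    rw [← hX, Submodule.span_le]
    rintro _ ⟨x, rfl⟩
    exact spanOf_mono (Finset.union_subset_union_right (Finset.filter_subset _ _)) (high x)
  have hIact : I ⊆ intAct K X (B₀ ∪ I) := by
    intro b hb
    have hbB : b ∈ B₀ ∪ I := Finset.mem_union_right _ hb
    refine mem_intAct.2 ⟨hbB, hB.notMem_spanOf_erase hbB, fun x hx => ?_⟩
    refine spanOf_mono (fun z hz => ?_) (high x)
    rcases Finset.mem_union.1 hz with hz | hz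
    · exact Finset.mem_erase.2
        ⟨fun e => hIA b hb (e ▸ ((memB₀ z).1 hz).1), Finset.mem_union_left _ hz⟩
    · rw [Finset.mem_filter] at hz
      exact Finset.mem_erase.2 ⟨(hx.trans_le hz.2).ne', Finset.mem_union_right _ hz.1⟩
  refine ⟨B₀ ∪ I, I, hB, hIact, ?_⟩
  ext x
  rw [Finset.mem_sdiff, Finset.mem_union]
  constructor
  · intro hx
    refine ⟨?_, fun h => hIA x h hx⟩
    by_cases hxB : x ∈ B₀ ∪ I
    · exact Or.inl hxB
    · refine Or.inr (mem_extAct.2 ⟨hxB, spanOf_mono ?_ (low x hx)⟩)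
      exact Finset.filter_subset_filter _ Finset.subset_union_left
  · rintro ⟨h | h, hxI⟩
    · exact ((memB₀ x).1 ((Finset.mem_union.1 h).resolve_right hxI)).1
    · refine hA x (spanOf_mono (fun b hb => ?_) (hB.mem_spanOf_supp x))
      have h1 := Finset.mem_sdiff.1 (hB.supp_subset_sdiff hIact h hb)
      have h2 := Finset.mem_filter.1 (hB.supp_subset_filter h hb)
      exact Finset.mem_filter.2
        ⟨((memB₀ b).1 ((Finset.mem_union.1 h1.1).resolve_right h1.2)).1, h2.2⟩

end Matroid

/-! ### Spanning. -/

section Spanning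

variable {K : Type*} [Field K] {U : Type*} [AddCommGroup U] [Module K U]
variable {ι : Type*} {X : ι → U}

theorem range_pow_le_degLE {n d : ℕ} (h : n ≤ d) :
    LinearMap.range (SymmetricAlgebra.ι K U) ^ n ≤ degLE K U d :=
  le_iSup₂_of_le (f := fun n (_ : n ∈ Finset.range (d + 1)) =>
    LinearMap.range (SymmetricAlgebra.ι K U) ^ n) n (by simpa [Nat.lt_succ_iff] using h) le_rfl

theorem prod_pElem_pow_mem (s : Finset ι) (c : ι → ℕ) :
    ∏ x ∈ s, pElem K X x ^ c x ∈ LinearMap.range (SymmetricAlgebra.ι K U) ^ ∑ x ∈ s, c x := by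
  classical
  induction s using Finset.induction_on with
  | empty => simp
  | insert a s ha ih =>
    rw [Finset.prod_insert ha, Finset.sum_insert ha, pow_add]
    exact Submodule.mul_mem_mul (Submodule.pow_mem_pow _ (LinearMap.mem_range_self _ _) _) ih

theorem multiset_prod_pElem_mem (m : Multiset ι) :
    (m.map (pElem K X)).prod ∈ LinearMap.range (SymmetricAlgebra.ι K U) ^ m.card := by
  induction m using Multiset.induction_on with
  | empty => simp
  | cons a m ih =>
    rw [Multiset.map_cons, Multiset.prod_cons, Multiset.card_cons, pow_succ']
    exact Submodule.mul_mem_mul (LinearMap.mem_range_self _ _) ih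

theorem range_pow_le_span {B : Finset ι} (hB : spanOf K X B = ⊤) (n : ℕ) :
    LinearMap.range (SymmetricAlgebra.ι K U) ^ n ≤ Submodule.span K
      {f | ∃ m : Multiset ι, (∀ b ∈ m, b ∈ B) ∧ m.card = n ∧ f = (m.map (pElem K X)).prod} := by
  induction n with
  | zero =>
    rw [pow_zero, Submodule.one_le]
    exact Submodule.subset_span ⟨0, by simp⟩
  | succ n ih =>
    have h1 : LinearMap.range (SymmetricAlgebra.ι K U) ≤
        Submodule.span K (pElem K X '' (B : Set ι)) := by
      have : pElem K X '' (B : Set ι) = SymmetricAlgebra.ι K U '' (X '' (B : Set ι)) := by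
        rw [Set.image_image]
        rfl
      rw [this, Submodule.span_image, LinearMap.range_eq_map]
      exact Submodule.map_mono hB.ge
    rw [pow_succ']
    refine (mul_le_mul' h1 ih).trans ?_
    rw [Submodule.span_mul_span, Submodule.span_le]
    rintro _ ⟨_, ⟨b, hb, rfl⟩, _, ⟨m, hm, hn, rfl⟩, rfl⟩
    refine Submodule.subset_span ⟨b ::ₘ m, ?_, by simp [hn], by simp⟩
    intro c hc
    rcases Multiset.mem_cons.1 hc with rfl | hc
    · exact hb
    · exact hm c hc

theorem degLE_le_span {B : Finset ι} (hB : spanOf K X B = ⊤) (d : ℕ) :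
    degLE K U d ≤ Submodule.span K
      {f | ∃ m : Multiset ι, (∀ b ∈ m, b ∈ B) ∧ m.card ≤ d ∧ f = (m.map (pElem K X)).prod} := by
  refine iSup₂_le fun n hn => (range_pow_le_span hB n).trans (Submodule.span_mono ?_)
  rintro _ ⟨m, hm, hc, rfl⟩
  have := Finset.mem_range.1 hn
  exact ⟨m, hm, by lia, rfl⟩

variable [Fintype ι] [LinearOrder ι]

theorem pElem_mul_pProd_compl {A : Finset ι} {z : ι} (hz : z ∈ A) :
    pElem K X z * pProd K X Aᶜ = pProd K X (A.erase z)ᶜ := by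
  rw [Finset.compl_erase, pProd, pProd, Finset.prod_insert (by simpa using hz)]

variable {k : ℕ} {J : UpperSet (Flat K X)}

/-- The saturated subsequence `(B ∪ E(B)) ∖ I` belonging to `(B, I, a)`. -/
noncomputable def Gamma.sat (γ : Gamma k J) : Finset ι := (γ.B ∪ extAct K X γ.B) \ γ.I

/-- The exponents `a` of `(B, I, a)`, extended by zero. -/
def Gamma.exps (γ : Gamma k J) (x : ι) : ℕ := if h : x ∈ γ.I then γ.a ⟨x, h⟩ else 0

theorem Gamma.exps_coe (γ : Gamma k J) (x : {x // x ∈ γ.I}) : γ.exps x = γ.a x := by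
  simp [Gamma.exps]

theorem Gamma.sum_exps (γ : Gamma k J) : ∑ x ∈ γ.I, γ.exps x = ∑ x, γ.a x := by
  rw [← Finset.sum_coe_sort]
  exact Finset.sum_congr rfl fun x _ => γ.exps_coe x

theorem Gamma.sum_exps_lt (γ : Gamma k J) : ∑ x ∈ γ.I, γ.exps x + 1 ≤ k + chi J γ.sat := by
  have h := γ.sum_le
  rw [← Nat.cast_sum, ← γ.sum_exps] at h
  change _ ≤ (k : ℤ) + (chi J γ.sat : ℤ) - 1 at h
  lia

/-- The complement of the saturated set is the disjoint union of X ∖ (B ∪ E(B)) and I, so it takes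
one factor from each power a_x + 1. -/
theorem Gamma.poly_eq (γ : Gamma k J) :
    γ.poly = (∏ x ∈ γ.I, pElem K X x ^ γ.exps x) * pProd K X γ.satᶜ := by
  have hsub : γ.I ⊆ γ.B ∪ extAct K X γ.B := fun x hx =>
    Finset.mem_union_left _ (mem_intAct.1 (γ.subset_intAct hx)).1
  have h1 : γ.satᶜ = (γ.B ∪ extAct K X γ.B)ᶜ ∪ γ.I := by
    ext x
    simp only [Gamma.sat, Finset.mem_compl, Finset.mem_sdiff, Finset.mem_union]
    tauto
  have h2 : Disjoint (γ.B ∪ extAct K X γ.B)ᶜ γ.I :=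
    Finset.disjoint_left.2 fun x hx hxI => Finset.mem_compl.1 hx (hsub hxI)
  have h3 : ∏ x : {x // x ∈ γ.I}, pElem K X x.1 ^ (γ.a x + 1) =
      ∏ x ∈ γ.I, pElem K X x ^ (γ.exps x + 1) := by
    rw [← Finset.prod_coe_sort γ.I fun x => pElem K X x ^ (γ.exps x + 1)]
    exact Finset.prod_congr rfl fun x _ => by rw [γ.exps_coe x]
  rw [Gamma.poly, h3, h1, pProd, pProd, Finset.prod_union h2]
  simp only [pow_succ, Finset.prod_mul_distrib]
  ring

theorem basisSet_subset_PSpace : basisSet k J ⊆ (PSpace k J : Set (SymmetricAlgebra K U)) := by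
  rintro _ ⟨γ, rfl⟩
  change γ.poly ∈ PSpace k J
  have hlt := γ.sum_exps_lt
  have hchi := chi_le_one J γ.sat
  rw [γ.poly_eq]
  cases k with
  | zero =>
    -- For k = 0 the bound reads ∑ a_x + 1 ≤ χ ≤ 1, which forces a = 0 and χ = 1.
    have h0 : ∑ x ∈ γ.I, γ.exps x = 0 := by lia
    have h1 : chi J γ.sat = 1 := by lia
    rw [Finset.prod_congr rfl fun x hx => by rw [Finset.sum_eq_zero_iff.1 h0 x hx, pow_zero],
      Finset.prod_const_one, one_mul]
    refine Submodule.subset_span ⟨γ.satᶜ, ?_, rfl⟩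
    rw [compl_compl]
    by_contra hJ
    simp [chi, hJ] at h1
  | succ k =>
    by_cases hf : ∏ x ∈ γ.I, pElem K X x ^ γ.exps x = 0
    · rw [hf, zero_mul]
      exact zero_mem _
    · refine Submodule.subset_span ⟨γ.satᶜ, _, hf, ?_, rfl⟩
      rw [compl_compl]
      exact range_pow_le_degLE (by lia) (prod_pElem_pow_mem _ _)

omit [Fintype ι] in
/-- If `y` is in the span of the elements of `A` that precede it, then `p_y` is a combination of
those `p_z` for which `y` can be exchanged with `z` in `A`. -/
theorem exists_exchange {A : Finset ι} {y : ι} (hyA : y ∉ A)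
    (hy : X y ∈ spanOf K X (A.filter (· < y))) :
    ∃ c : ι → K, pElem K X y = ∑ z ∈ A.filter (· < y), c z • pElem K X z ∧
      ∀ z ∈ A.filter (· < y), c z ≠ 0 → spanOf K X ((insert y A).erase z) = spanOf K X A := by
  obtain ⟨c, hc⟩ := (Submodule.mem_span_image_finset_iff_exists_fun' K).1 hy
  refine ⟨c, ?_, fun z hz hcz => le_antisymm ?_ ?_⟩
  · simp only [pElem, ← hc, map_sum, map_smul]
  · refine spanOf_le.2 fun x hx => ?_
    rcases Finset.mem_insert.1 (Finset.mem_of_mem_erase hx) with rfl | hx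
    · exact spanOf_mono (Finset.filter_subset _ _) hy
    · exact mem_spanOf hx
  · have key : ∀ x ∈ A, x ≠ z → X x ∈ spanOf K X ((insert y A).erase z) := fun x hx hxz =>
      mem_spanOf (Finset.mem_erase.2 ⟨hxz, Finset.mem_insert_of_mem hx⟩)
    refine spanOf_le.2 fun x hx => ?_
    by_cases hxz : x = z
    · subst hxz
      rw [← Finset.add_sum_erase _ _ hz] at hc
      have hxy : y ≠ x := fun e => hyA (e ▸ hx)
      have h1 : c x • X x ∈ spanOf K X ((insert y A).erase x) := by
        rw [eq_sub_of_add_eq hc]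
        refine sub_mem (mem_spanOf (Finset.mem_erase.2 ⟨hxy, Finset.mem_insert_self _ _⟩))
          (sum_mem fun z hz => Submodule.smul_mem _ _ ?_)
        rw [Finset.mem_erase, Finset.mem_filter] at hz
        exact key z hz.2.1 hz.1
      exact (Submodule.smul_mem_iff _ hcz).1 h1
    · exact key x hx hxz

theorem mul_pProd_mem_span_basisSet [FiniteDimensional K U]
    (hX : Submodule.span K (Set.range X) = ⊤) {A : Finset ι} {d : ℕ} {f : SymmetricAlgebra K U}
    (hd : d + 1 ≤ k + chi J A) (hf : f ∈ degLE K U d) :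
    f * pProd K X Aᶜ ∈ Submodule.span K (basisSet k J) := by
  -- A positive, strictly decreasing weight: the total over A drops both when an element is removed
  -- and when z is exchanged for a later y.
  let w : ι → ℕ := fun x => (Finset.univ.filter (x ≤ ·)).card
  have wpos : ∀ x, 0 < w x := fun x => Finset.card_pos.2 ⟨x, by simp⟩
  have wlt : ∀ x y, x < y → w y < w x := fun x y h => by
    refine Finset.card_lt_card (Finset.ssubset_iff_subset_ne.2 ⟨?_, fun e => ?_⟩)
    · exact Finset.monotone_filter_right _ fun _ _ h' => h.le.trans h'
    · have : x ∈ Finset.univ.filter (y ≤ ·) := by simp [e]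
      exact absurd h (not_lt.2 (by simpa using this))
  induction hn : ∑ x ∈ A, w x using Nat.strong_induction_on generalizing A d f with
  | _ n ih =>
  by_cases hA : Saturated K X A
  · obtain ⟨B, I, hB, hI, rfl⟩ := hA.exists_isBase hX
    set A := (B ∪ extAct K X B) \ I with hAdef
    suffices h : degLE K U d ≤ (Submodule.span K (basisSet k J)).comap
        (LinearMap.mulRight K (pProd K X Aᶜ)) from h hf
    refine (degLE_le_span hB.spanOf_eq_top d).trans (Submodule.span_le.2 ?_)
    rintro _ ⟨m, hmB, hm, rfl⟩
    change (m.map (pElem K X)).prod * pProd K X Aᶜ ∈ Submodule.span K (basisSet k J)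
    by_cases hmI : ∀ b ∈ m, b ∈ I
    · have hsum : ∑ x ∈ I, m.count x = m.card := Multiset.sum_count_eq_card hmI
      let γ : Gamma k J := ⟨B, hB, I, hI, fun x => m.count x.1, by
        rw [← Nat.cast_sum, Finset.sum_coe_sort I (fun x => m.count x), hsum]
        change _ ≤ (k : ℤ) + (chi J A : ℤ) - 1
        lia⟩
      refine Submodule.subset_span ⟨γ, ?_⟩
      change γ.poly = _
      rw [γ.poly_eq, Finset.prod_multiset_map_count]
      congr 1
      rw [Finset.prod_subset (fun x hx => hmI x (Multiset.mem_toFinset.1 hx))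
        (fun x _ hx => by
          rw [Multiset.count_eq_zero_of_notMem fun h => hx (Multiset.mem_toFinset.2 h), pow_zero])]
      refine Finset.prod_congr rfl fun x hx => ?_
      rw [γ.exps_coe ⟨x, hx⟩]
    · push Not at hmI
      obtain ⟨b, hbm, hbI⟩ := hmI
      obtain ⟨m, rfl⟩ := Multiset.exists_cons_of_mem hbm
      have hbA : b ∈ A := Finset.mem_sdiff.2 ⟨Finset.mem_union_left _ (hmB b hbm), hbI⟩
      rw [Multiset.map_cons, Multiset.prod_cons, mul_right_comm, mul_comm,
        pElem_mul_pProd_compl hbA]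
      rw [Multiset.card_cons] at hm
      have hchi := chi_le_one J A
      -- Removing b may lower χ by one; the degree has dropped by one as well, so the bound
      -- survives.
      refine ih _ ?_ (d := m.card) (by lia)
        (range_pow_le_degLE le_rfl (multiset_prod_pElem_mem m)) rfl
      rw [← hn, ← Finset.add_sum_erase _ _ hbA]
      have := wpos b
      lia
  · unfold Saturated at hA
    push Not at hA
    obtain ⟨y, hy, hyA⟩ := hA
    obtain ⟨c, hc, hspan⟩ := exists_exchange hyA hy
    have h1 : pProd K X Aᶜ = pElem K X y * pProd K X (insert y A)ᶜ := by
      rw [pElem_mul_pProd_compl (Finset.mem_insert_self y A), Finset.erase_insert hyA]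
    rw [h1, hc, Finset.sum_mul, Finset.mul_sum]
    refine sum_mem fun z hz => ?_
    by_cases hcz : c z = 0
    · simp [hcz]
    have hzA := (Finset.mem_filter.1 hz).1
    have hzy := (Finset.mem_filter.1 hz).2
    rw [smul_mul_assoc, mul_smul_comm, pElem_mul_pProd_compl (Finset.mem_insert_of_mem hzA)]
    refine Submodule.smul_mem _ _ (ih _ ?_ (d := d) ?_ hf rfl)
    · have h2 := Finset.add_sum_erase _ w (Finset.mem_insert_of_mem (b := y) hzA)
      rw [Finset.sum_insert hyA] at h2
      have := wlt z y hzy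
      lia
    -- The exchange preserves the span, hence χ and the degree bound.
    · rwa [chi_congr J (hspan z hz hcz)]

theorem span_basisSet [FiniteDimensional K U] (hX : Submodule.span K (Set.range X) = ⊤) :
    Submodule.span K (basisSet k J) = PSpace k J := by
  refine le_antisymm (Submodule.span_le.2 basisSet_subset_PSpace) (Submodule.span_le.2 ?_)
  intro g hg
  cases k with
  | zero =>
    obtain ⟨Y, hY, rfl⟩ := hg
    have h := mul_pProd_mem_span_basisSet (k := 0) (J := J) hX (A := Yᶜ) (d := 0) (f := 1)
      (by simp [chi, hY]) (range_pow_le_degLE le_rfl (by simp))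
    rwa [one_mul, compl_compl] at h
  | succ k =>
    obtain ⟨Y, f, -, hf, rfl⟩ := hg
    have h := mul_pProd_mem_span_basisSet (k := k + 1) (J := J) hX (A := Yᶜ) (by lia) hf
    rwa [compl_compl] at h

end Spanning

/-! ### Linear independence. -/

section Independence

variable {K : Type*} [Field K] {U : Type*} [AddCommGroup U] [Module K U]

/-- The canonical map `Sym(U) → Sym(U / W)`. -/
noncomputable def quotMap (W : Submodule K U) :
    SymmetricAlgebra K U →ₐ[K] SymmetricAlgebra K (U ⧸ W) :=
  SymmetricAlgebra.lift (SymmetricAlgebra.ι K (U ⧸ W) ∘ₗ W.mkQ)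

theorem quotMap_ι (W : Submodule K U) (u : U) :
    quotMap W (SymmetricAlgebra.ι K U u) = SymmetricAlgebra.ι K (U ⧸ W) (W.mkQ u) := by
  simp [quotMap]

theorem quotMap_ι_eq_zero {W : Submodule K U} {u : U} (h : u ∈ W) :
    quotMap W (SymmetricAlgebra.ι K U u) = 0 := by
  rw [quotMap_ι, Submodule.mkQ_apply, (Submodule.Quotient.mk_eq_zero W).2 h, map_zero]

theorem quotMap_ι_ne_zero {W : Submodule K U} {u : U} (h : u ∉ W) :
    quotMap W (SymmetricAlgebra.ι K U u) ≠ 0 := by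
  rw [quotMap_ι, Submodule.mkQ_apply]
  intro h0
  refine h ((Submodule.Quotient.mk_eq_zero W).1 ?_)
  refine (Module.forall_dual_apply_eq_zero_iff K _).1 fun g => ?_
  rw [← SymmetricAlgebra.lift_ι_apply g, h0, map_zero]

/-- Such a ψ factors through Sym(U / W). -/
theorem eq_zero_of_quotMap_eq_zero {W : Submodule K U} {A : Type*} [CommRing A] [Algebra K A]
    (ψ : SymmetricAlgebra K U →ₐ[K] A) (hψ : ∀ u ∈ W, ψ (SymmetricAlgebra.ι K U u) = 0)
    {f : SymmetricAlgebra K U} (hf : quotMap W f = 0) : ψ f = 0 := by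
  let g : U →ₗ[K] A := ψ.toLinearMap ∘ₗ SymmetricAlgebra.ι K U
  have hg : W ≤ LinearMap.ker g := fun u hu => hψ u hu
  have h : ψ = (SymmetricAlgebra.lift (W.liftQ g hg)).comp (quotMap W) := by
    refine SymmetricAlgebra.algHom_ext (LinearMap.ext fun u => ?_)
    simp [quotMap_ι, g]
  rw [h, AlgHom.comp_apply, hf, map_zero]

theorem quotMap_eq_zero_of_le {W W' : Submodule K U} (h : W ≤ W') {f : SymmetricAlgebra K U}
    (hf : quotMap W f = 0) : quotMap W' f = 0 :=
  eq_zero_of_quotMap_eq_zero _ (fun _ hu => quotMap_ι_eq_zero (h hu)) hf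

variable [FiniteDimensional K U]
variable {ι : Type*} [Fintype ι] [LinearOrder ι] {X : ι → U} {k : ℕ} {J : UpperSet (Flat K X)}

theorem Gamma.ext_sat {γ γ' : Gamma k J} (hsat : γ.sat = γ'.sat) (hexps : γ.exps = γ'.exps) :
    γ = γ' := by
  have hI : γ.I = γ'.I := by
    ext x
    rw [γ.isBase.mem_active_iff γ.subset_intAct, γ'.isBase.mem_active_iff γ'.subset_intAct]
    change _ ∉ spanOf K X (γ.sat ∪ _) ↔ _ ∉ spanOf K X (γ'.sat ∪ _)
    rw [hsat]
  have hB : γ.B = γ'.B := by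
    ext x
    rw [γ.isBase.mem_base_iff γ.subset_intAct, γ'.isBase.mem_base_iff γ'.subset_intAct]
    change _ ∈ γ.I ∨ _ ∈ γ.sat ∧ _ ∉ spanOf K X (γ.sat.filter _) ↔
      _ ∈ γ'.I ∨ _ ∈ γ'.sat ∧ _ ∉ spanOf K X (γ'.sat.filter _)
    rw [hsat, hI]
  have ha : ∀ x (h : x ∈ γ.I) (h' : x ∈ γ'.I), γ.a ⟨x, h⟩ = γ'.a ⟨x, h'⟩ := fun x h h' => by
    rw [← γ.exps_coe, ← γ'.exps_coe, hexps]
  obtain ⟨B, h1, I, h2, a, h3⟩ := γ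
  obtain ⟨B', h1', I', h2', a', h3'⟩ := γ'
  obtain rfl : B = B' := hB
  obtain rfl : I = I' := hI
  obtain rfl : a = a' := funext fun x => ha x.1 x.2 x.2
  rfl

/-- The part of the polynomial with index `(B, I, a)` that remains if the factors `p_x` with
`x ∉ S` and `x ∉ (B ∪ E(B)) ∖ I` are omitted. -/
noncomputable def Gamma.partialPoly (S : Finset ι) (γ : Gamma k J) : SymmetricAlgebra K U :=
  (∏ x ∈ γ.I, pElem K X x ^ γ.exps x) * pProd K X (S \ γ.sat)

/-- All triples in the support share B and I, and span A = span (B ∖ I). Hence I is a basis modulo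
span A, and the remaining products are distinct monomials in it. -/
theorem Gamma.eq_zero_of_sat_eq {A : Finset ι} {l : Gamma k J →₀ K}
    (hl : ∀ γ ∈ l.support, γ.sat = A)
    (h : quotMap (spanOf K X A) (Finsupp.linearCombination K (Gamma.partialPoly ∅) l) = 0) :
    l = 0 := by
  by_contra hne
  obtain ⟨γ₀, hγ₀⟩ := Finsupp.support_nonempty_iff.2 hne
  -- Coordinates on U / span A: elements of I become variables, the rest of B vanishes.
  let g : U →ₗ[K] MvPolynomial ι K := γ₀.isBase.basis.constr K
    fun b => if b.1 ∈ γ₀.I then MvPolynomial.X b.1 else 0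
  have hg : ∀ b ∈ γ₀.B, g (X b) = if b ∈ γ₀.I then MvPolynomial.X b else 0 := fun b hb => by
    have := γ₀.isBase.basis.constr_basis K
      (fun b => if b.1 ∈ γ₀.I then (MvPolynomial.X b.1 : MvPolynomial ι K) else 0) ⟨b, hb⟩
    rwa [γ₀.isBase.basis_apply] at this
  have hA : spanOf K X A ≤ LinearMap.ker g := by
    rw [← hl γ₀ hγ₀]
    refine (γ₀.isBase.spanOf_sdiff γ₀.subset_intAct).trans (spanOf_le.2 fun b hb => ?_)
    rw [Finset.mem_sdiff] at hb
    rw [LinearMap.mem_ker, hg b hb.1, if_neg hb.2]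
  let e : Gamma k J → ι →₀ ℕ := fun γ => Finsupp.equivFunOnFinite.symm γ.exps
  have hpoly : ∀ γ ∈ l.support, SymmetricAlgebra.lift g (γ.partialPoly ∅) =
      MvPolynomial.monomial (e γ) (1 : K) := fun γ hγ => by
    have hI : γ.I = γ₀.I := by
      ext x
      rw [γ.isBase.mem_active_iff γ.subset_intAct, γ₀.isBase.mem_active_iff γ₀.subset_intAct]
      change _ ∉ spanOf K X (γ.sat ∪ _) ↔ _ ∉ spanOf K X (γ₀.sat ∪ _)
      rw [hl γ hγ, hl γ₀ hγ₀]
    rw [Gamma.partialPoly, Finset.empty_sdiff, pProd, Finset.prod_empty, mul_one, map_prod,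
      MvPolynomial.monomial_eq, Finsupp.prod_fintype _ _ (by simp), map_one, one_mul,
      ← Finset.prod_subset (Finset.subset_univ γ.I) (fun x _ hx => by simp [e, Gamma.exps, hx])]
    refine Finset.prod_congr rfl fun x hx => ?_
    rw [hI] at hx
    rw [map_pow, pElem, SymmetricAlgebra.lift_ι_apply,
      hg x (mem_intAct.1 (γ₀.subset_intAct hx)).1, if_pos hx]
    rfl
  have h1 := eq_zero_of_quotMap_eq_zero (SymmetricAlgebra.lift g) (fun u hu => by
    rw [SymmetricAlgebra.lift_ι_apply]
    exact hA hu) h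
  rw [Finsupp.linearCombination_apply, Finsupp.sum, map_sum,
    Finset.sum_congr rfl fun γ hγ => by rw [map_smul, hpoly γ hγ]] at h1
  have h2 := congrArg (MvPolynomial.coeff (e γ₀)) h1
  rw [MvPolynomial.coeff_sum, Finset.sum_eq_single γ₀] at h2
  · exact Finsupp.mem_support_iff.1 hγ₀ (by simpa using h2)
  · intro γ hγ hne'
    have : e γ ≠ e γ₀ := fun he => hne' (Gamma.ext_sat ((hl γ hγ).trans (hl γ₀ hγ₀).symm)
      (Finsupp.equivFunOnFinite.symm.injective he))
    simp [MvPolynomial.coeff_monomial, this]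
  · exact fun h => absurd hγ₀ h

/-- The polynomials belonging to the triples `(B, I, a)` for which `(B ∪ E(B)) ∖ I` has a given
intersection `A` with the lower set `X ∖ S`, without the factors in `X ∖ S`, are linearly
independent modulo the span of `A`. -/
theorem Gamma.eq_zero_of_quotMap (S : Finset ι) : (∀ a ∈ S, ∀ b, a < b → b ∈ S) →
    ∀ (A : Finset ι) (l : Gamma k J →₀ K), (∀ γ ∈ l.support, γ.sat \ S = A) →
    quotMap (spanOf K X A) (Finsupp.linearCombination K (Gamma.partialPoly S) l) = 0 →
    l = 0 := by
  classical
  induction S using Finset.induction_on_min with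
  | empty => exact fun _ A l hl h => Gamma.eq_zero_of_sat_eq (by simpa using hl) h
  | insert a s hs ih =>
    intro hS A l hl h
    have has : a ∉ s := fun h => lt_irrefl a (hs a h)
    -- As S is an upper set with minimum a, the condition on the support fixes exactly the part of
    -- each saturated set before a.
    have hmem : ∀ b, b ∈ s ↔ a < b := fun b => ⟨hs b, fun hb =>
      (Finset.mem_insert.1 (hS a (Finset.mem_insert_self _ _) b hb)).resolve_left hb.ne'⟩
    have hs' : ∀ c ∈ s, ∀ b, c < b → b ∈ s := fun c hc b hb =>
      (hmem b).2 (((hmem c).1 hc).trans hb)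
    have hlow : ∀ γ ∈ l.support, γ.sat.filter (· < a) = A := fun γ hγ => by
      rw [← hl γ hγ]
      ext x
      rw [Finset.mem_filter, Finset.mem_sdiff, Finset.mem_insert, hmem, ← le_iff_eq_or_lt', not_le]
    have hin : ∀ γ ∈ l.support, a ∈ γ.sat → γ.sat \ s = insert a A := fun γ hγ ha => by
      rw [← hl γ hγ]
      ext x
      simp only [Finset.mem_sdiff, Finset.mem_insert]
      by_cases hx : x = a
      · simp [hx, ha, has]
      · simp [hx]
    have hout : ∀ γ ∈ l.support, a ∉ γ.sat → γ.sat \ s = A := fun γ hγ ha => by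
      rw [← hl γ hγ, Finset.sdiff_insert_of_notMem ha]
    have hpin : ∀ γ : Gamma k J, a ∈ γ.sat → γ.partialPoly (insert a s) = γ.partialPoly s :=
      fun γ ha => by
        rw [Gamma.partialPoly, Gamma.partialPoly, Finset.insert_sdiff_of_mem _ ha]
    have hpout : ∀ γ : Gamma k J, a ∉ γ.sat →
        γ.partialPoly (insert a s) = pElem K X a * γ.partialPoly s := fun γ ha => by
      rw [Gamma.partialPoly, Gamma.partialPoly, Finset.insert_sdiff_of_notMem _ ha, pProd, pProd,
        Finset.prod_insert (fun h => has (Finset.mem_sdiff.1 h).1), mul_left_comm]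
    set l₁ := l.filter fun γ => a ∈ γ.sat with hl₁
    set l₂ := l.filter fun γ => a ∉ γ.sat with hl₂
    have hsum : l = l₁ + l₂ := (Finsupp.filter_add_filter_not l _).symm
    have hsup₁ : ∀ γ ∈ l₁.support, γ ∈ l.support ∧ a ∈ γ.sat := by
      simp [hl₁, Finsupp.support_filter]
    have hsup₂ : ∀ γ ∈ l₂.support, γ ∈ l.support ∧ a ∉ γ.sat := by
      simp [hl₂, Finsupp.support_filter]
    have e₁ : Finsupp.linearCombination K (Gamma.partialPoly (insert a s)) l₁ =
        Finsupp.linearCombination K (Gamma.partialPoly s) l₁ := by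
      simp only [Finsupp.linearCombination_apply, Finsupp.sum]
      exact Finset.sum_congr rfl fun γ hγ => by rw [hpin γ (hsup₁ γ hγ).2]
    have e₂ : Finsupp.linearCombination K (Gamma.partialPoly (insert a s)) l₂ =
        pElem K X a * Finsupp.linearCombination K (Gamma.partialPoly s) l₂ := by
      simp only [Finsupp.linearCombination_apply, Finsupp.sum, Finset.mul_sum]
      exact Finset.sum_congr rfl fun γ hγ => by rw [hpout γ (hsup₂ γ hγ).2, mul_smul_comm]
    rw [hsum, map_add, e₁, e₂] at h
    -- Modulo span (A ∪ a) the factor p_a kills all terms of `l₂`.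
    have hz₁ : l₁ = 0 := by
      refine ih hs' (insert a A) l₁ (fun γ hγ => hin γ (hsup₁ γ hγ).1 (hsup₁ γ hγ).2) ?_
      have h1 := quotMap_eq_zero_of_le (spanOf_mono (Finset.subset_insert a A)) h
      rwa [map_add, map_mul, pElem, quotMap_ι_eq_zero (mem_spanOf (Finset.mem_insert_self a A)),
        zero_mul, add_zero] at h1
    have hz₂ : l₂ = 0 := by
      by_cases ha : X a ∈ spanOf K X A
      -- Here p_a is zero in the quotient, but saturation forces a into each set, so `l₂` has no
      -- terms.
      · rw [← Finsupp.support_eq_empty, Finset.eq_empty_iff_forall_notMem]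
        intro γ hγ
        obtain ⟨hγl, hγa⟩ := hsup₂ γ hγ
        refine hγa (γ.isBase.saturated_sdiff γ.subset_intAct a ?_)
        change X a ∈ spanOf K X (γ.sat.filter (· < a))
        rwa [hlow γ hγl]
      · refine ih hs' A l₂ (fun γ hγ => hout γ (hsup₂ γ hγ).1 (hsup₂ γ hγ).2) ?_
        rw [hz₁, map_zero, zero_add, map_mul] at h
        exact (mul_eq_zero.1 h).resolve_left (quotMap_ι_ne_zero ha)
    rw [hsum, hz₁, hz₂, add_zero]

theorem Gamma.linearIndependent : LinearIndependent K fun γ : Gamma k J => γ.poly := by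
  rw [linearIndependent_iff]
  intro l hl
  have h : (fun γ : Gamma k J => γ.poly) = Gamma.partialPoly Finset.univ := by
    funext γ
    rw [γ.poly_eq, Gamma.partialPoly, Finset.compl_eq_univ_sdiff]
  rw [h] at hl
  refine Gamma.eq_zero_of_quotMap Finset.univ (fun _ _ _ _ => Finset.mem_univ _) ∅ l
    (fun γ _ => by simp) ?_
  rw [hl, map_zero]

end Independence

end Zonotopal

theorem mainTheorem3 {K : Type*} [Field K] [CharZero K]
    {V : Type*} [AddCommGroup V] [Module K V] [FiniteDimensional K V]
    (hr : 1 ≤ Module.finrank K V)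
    {N : ℕ} (X : Fin N → Module.Dual K V) (hX : Submodule.span K (Set.range X) = ⊤)
    (J : UpperSet (Zonotopal.Flat K X)) (hJ : (J : Set (Zonotopal.Flat K X)).Nonempty)
    (k : ℕ) :
    LinearIndepOn K id (Zonotopal.basisSet k J) ∧
      Submodule.span K (Zonotopal.basisSet k J) = Zonotopal.PSpace k J ∧
      Function.Injective (fun γ : Zonotopal.Gamma k J => γ.poly) :=
  ⟨Zonotopal.Gamma.linearIndependent.linearIndepOn_id, Zonotopal.span_basisSet hX,
    Zonotopal.Gamma.linearIndependent.injective⟩
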